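/- Let $C_1=\mathrm{Id}_2$, $C_2=\begin{pmatrix}0&0\\1&0\end{pmatrix}$, $D=\begin{pmatrix}1&0\\0&-1\end{pmatrix}$, $E=\begin{pmatrix}0&1\\0&0\end{pmatrix}$. For complex constants $c,\alpha,c_0,c_1$, let $\nabla=\nabla(c,\alpha,c_0,c_1)$ be the meromorphic connection in Birkhoff normal form on the germ $(\mathcal O_{(\mathbb C,0)})^2$ with connection form $$\Omega=\frac1{z^2}\left(B_0+zB_\infty\right)dz,\qquad B_0=cC_1+c_0C_2,\qquad B_\infty=\alpha C_1+c_1C_2-\tfrac14D+c_0E .$$ Let $\tilde\nabla$ be the connection of the same form, with constants $\tilde c,\tilde\alpha,\tilde c_0,\tilde c_1$ and matrices $\tilde B_0,\tilde B_\infty$. A formal (respectively holomorphic) isomorphism between $\nabla$ and $\tilde\nabla$ is a $2\times2$ matrix $T$ with entries in $\mathbb C[[z]]$ (respectively in $\mathbb C\{z\}$) with $T(0)$ invertible and $$z^2\,\partial_zT+(B_0+zB_\infty)\,T-T\,(\tilde B_0+z\tilde B_\infty)=0 .$$ Assume that $c_0\tilde c_0\neq0$. (i) If $\nabla$ and $\tilde\nabla$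 are formally isomorphic, then $c=\tilde c$, $\alpha=\tilde\alpha$ and $c_0=\epsilon\tilde c_0$ for some $\epsilon\in\{\pm1\}$. (ii) Assume that $c=\tilde c$, $\alpha=\tilde\alpha$ and $c_0=\epsilon\tilde c_0$ with $\epsilon\in\{\pm1\}$. If $c_1=\epsilon\tilde c_1$, then $\nabla$ and $\tilde\nabla$ are holomorphically isomorphic. If $c_1\neq\epsilon\tilde c_1$, then $\nabla$ and $\tilde\nabla$ are holomorphically isomorphic if and only if there is an integer $n\ge2$ such that $$4c_0^2(c_1-\epsilon\tilde c_1)^2-8(n-1)^2c_0(c_1+\epsilon\tilde c_1)+(2n-1)(2n-3)(n-1)^2=0$$ and, for every integer $r$ with $2\le r\le n-1$, $$c_0(c_1+\epsilon\tilde c_1)\neq\frac{(2n-1)(2n-3)(n-1)^2-(2r-1)(2r-3)(r-1)^2}{8(n-r)(n-2+r)} .$$ -/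

import Mathlib

open Filter Topology

namespace BirkhoffRankTwo

/-- Complex `2 × 2` matrices. -/
abbrev Mat2 : Type := Matrix (Fin 2) (Fin 2) ℂ

def matC1 : Mat2 := 1

def matC2 : Mat2 := !![0, 0; 1, 0]

def matD : Mat2 := !![1, 0; 0, -1]

def matE : Mat2 := !![0, 1; 0, 0]

/-- A rank two meromorphic connection in Birkhoff normal form, with pole of Poincaré rank one:
the connection on the germ at `0 ∈ ℂ` of the trivial rank two holomorphic bundle whose connection
form in the standard basis is `Ω = z⁻² (B₀ + z B∞) dz`, with `B₀`, `B∞` constant matrices. -/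
@[ext]
structure BirkhoffConnection where
  B0 : Mat2
  Binf : Mat2

namespace BirkhoffConnection

/-- The holomorphic matrix `B(z) = z² Ω_{∂_z} = B₀ + z B∞`. -/
def holMatrix (N : BirkhoffConnection) (z : ℂ) : Mat2 :=
  N.B0 + z • N.Binf

/-- The matrix `B₀ + z B∞`, with entries in the ring `ℂ[[z]]`. -/
noncomputable def formalMatrix (N : BirkhoffConnection) :
    Matrix (Fin 2) (Fin 2) (PowerSeries ℂ) :=
  N.B0.map (PowerSeries.C (R := ℂ)) +
    (PowerSeries.X : PowerSeries ℂ) • N.Binf.map (PowerSeries.C (R := ℂ))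

/-- A formal isomorphism `T` between the connections with matrices `B` and `B'`: a matrix of formal
power series `T = ∑ T⁽ᵏ⁾ zᵏ` with `T⁽⁰⁾` invertible such that `z² ∂_z T + B T - T B' = 0`. -/
def IsFormalIso (N N' : BirkhoffConnection) (T : Matrix (Fin 2) (Fin 2) (PowerSeries ℂ)) : Prop :=
  IsUnit (T.map (PowerSeries.constantCoeff (R := ℂ))) ∧
    (PowerSeries.X : PowerSeries ℂ) ^ 2 • T.map (fun f => PowerSeries.derivative ℂ f)
      + N.formalMatrix * T - T * N'.formalMatrix = 0

/-- A holomorphic isomorphism `T` between the connections with matrices `B` and `B'`: (a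
representative of) a germ at `0` of a holomorphic matrix-valued function with `T(0)` invertible such
that `z² ∂_z T + B T - T B' = 0` near `0`. -/
def IsHolIso (N N' : BirkhoffConnection) (T : ℂ → Mat2) : Prop :=
  (∀ i j, AnalyticAt ℂ (fun z => T z i j) 0) ∧ IsUnit (T 0) ∧
    ∀ᶠ z in 𝓝 (0 : ℂ),
      z ^ 2 • Matrix.of (fun i j => deriv (fun w => T w i j) z)
        + N.holMatrix z * T z - T z * N'.holMatrix z = 0

def FormallyIsomorphic (N N' : BirkhoffConnection) : Prop :=
  ∃ T : Matrix (Fin 2) (Fin 2) (PowerSeries ℂ), IsFormalIso N N' T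

def HolomorphicallyIsomorphic (N N' : BirkhoffConnection) : Prop :=
  ∃ T : ℂ → Mat2, IsHolIso N N' T

end BirkhoffConnection

/-- The Birkhoff normal form with `B₀ = c C₁ + c₀ C₂` and
`B∞ = α C₁ + c₁ C₂ - (1/4) D + c₀ E`. -/
noncomputable def normalForm (c α c₀ c₁ : ℂ) : BirkhoffConnection where
  B0 := c • matC1 + c₀ • matC2
  Binf := α • matC1 + c₁ • matC2 - (1 / 4 : ℂ) • matD + c₀ • matE

end BirkhoffRankTwo

namespace BirkhoffRankTwo

/-! Expand an isomorphism as `T = ∑ T⁽ᵏ⁾ zᵏ` with entries `p, q, u, v` and compare coefficients. The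
lowest orders force `c = c'`, `α = α'` and `a² = a'²`, which is (i).

For (ii), put `a' = ε a`, `s' = ε t`. Eliminating `p, u, v` leaves a two-term recurrence for the
entry `q` (`CoeffSystem.rec_q`), namely `8a²k(2k+1) q (k+1) = recNum a s t k * q k`, with `q 1` a
nonzero multiple of `t - s` (`CoeffSystem.q_one`). As `recNum` has degree 4 in `k` and the left
factor degree 2, a sequence `q` that never stops grows too fast to converge (`not_summable_of_rec`).
So for `s ≠ t` a holomorphic isomorphism forces `recNum` to vanish at some integer `k ≥ 1`.
Conversely, a root, or `s = t`, makes `q` terminate; `p, u, v` are then recovered from `q` and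
terminate too, so `T` is polynomial (`exists_coeffSystem`). The condition on `n = k + 1` and `r`
selects the smallest root. -/

open PowerSeries

/-! ### Taylor series of analytic germs -/

/-- The Taylor series at `0` of a function of one complex variable. -/
noncomputable def taylor (f : ℂ → ℂ) : PowerSeries ℂ :=
  PowerSeries.mk fun n => iteratedDeriv n f 0 / n.factorial

theorem coeff_taylor (f : ℂ → ℂ) (n : ℕ) :
    coeff n (taylor f) = iteratedDeriv n f 0 / n.factorial := by
  simp [taylor]

theorem taylor_congr {f g : ℂ → ℂ} (h : f =ᶠ[𝓝 0] g) : taylor f = taylor g := by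
  ext n
  rw [coeff_taylor, coeff_taylor, h.iteratedDeriv_eq]

theorem taylor_add {f g : ℂ → ℂ} (hf : AnalyticAt ℂ f 0) (hg : AnalyticAt ℂ g 0) :
    taylor (fun z => f z + g z) = taylor f + taylor g := by
  ext n
  rw [map_add, coeff_taylor, coeff_taylor, coeff_taylor,
    iteratedDeriv_fun_add hf.contDiffAt hg.contDiffAt, add_div]

theorem taylor_sub {f g : ℂ → ℂ} (hf : AnalyticAt ℂ f 0) (hg : AnalyticAt ℂ g 0) :
    taylor (fun z => f z - g z) = taylor f - taylor g := by
  ext n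
  rw [map_sub, coeff_taylor, coeff_taylor, coeff_taylor,
    iteratedDeriv_fun_sub hf.contDiffAt hg.contDiffAt, sub_div]

theorem taylor_mul {f g : ℂ → ℂ} (hf : AnalyticAt ℂ f 0) (hg : AnalyticAt ℂ g 0) :
    taylor (fun z => f z * g z) = taylor f * taylor g := by
  ext n
  rw [PowerSeries.coeff_mul, coeff_taylor, iteratedDeriv_fun_mul hf.contDiffAt hg.contDiffAt,
    Finset.Nat.sum_antidiagonal_eq_sum_range_succ
      (fun i j => coeff i (taylor f) * coeff j (taylor g)), Finset.sum_div]
  refine Finset.sum_congr rfl fun i hi => ?_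
  have hi : i ≤ n := Nat.lt_succ_iff.mp (Finset.mem_range.mp hi)
  rw [coeff_taylor, coeff_taylor, Nat.cast_choose ℂ hi]
  have := Nat.factorial_ne_zero
  field_simp [this]

theorem taylor_const (a : ℂ) : taylor (fun _ => a) = C a := by
  ext n
  rw [coeff_taylor, iteratedDeriv_const, coeff_C]
  split_ifs with h <;> simp [h]

theorem taylor_id : taylor (fun z => z) = X := by
  ext n
  rw [coeff_taylor, coeff_X]
  rcases n with _ | _ | n
  · simp
  · simp
  · rw [iteratedDeriv_succ', iteratedDeriv_succ']
    simp

theorem taylor_deriv (f : ℂ → ℂ) : taylor (deriv f) = derivative ℂ (taylor f) := by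
  ext n
  rw [coeff_derivative, coeff_taylor, coeff_taylor, iteratedDeriv_succ', Nat.factorial_succ]
  have h : ((n : ℂ) + 1) ≠ 0 := by exact_mod_cast n.succ_ne_zero
  have h' : (n.factorial : ℂ) ≠ 0 := by exact_mod_cast n.factorial_ne_zero
  push_cast
  field_simp

theorem exists_summable_coeff_taylor {f : ℂ → ℂ} (hf : AnalyticAt ℂ f 0) :
    ∃ z : ℂ, z ≠ 0 ∧ Summable fun n => coeff n (taylor f) * z ^ n := by
  obtain ⟨r, hr⟩ := hf.hasFPowerSeriesAt
  obtain ⟨ρ, hρ, hρr⟩ := ENNReal.lt_iff_exists_nnreal_btwn.mp hr.r_pos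
  refine ⟨(ρ : ℝ), ?_, ?_⟩
  · have : ρ ≠ 0 := by
      rintro rfl
      simp at hρ
    exact_mod_cast this
  · have hmem : (((ρ : ℝ) : ℂ)) ∈ Metric.eball (0 : ℂ) r := by
      simpa [Metric.mem_eball, edist_zero_right, enorm_eq_nnnorm] using hρr
    have := (hr.hasSum hmem).summable
    refine this.congr fun n => ?_
    rw [coeff_taylor, FormalMultilinearSeries.ofScalars_apply_eq]
    simp

/-! ### Passage between holomorphic and formal isomorphisms -/

namespace BirkhoffConnection

/-- The `(i, j)` entry of `z² ∂_z T + B T - T B'` over `ℂ[[z]]`. -/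
noncomputable def formalEntry (N N' : BirkhoffConnection)
    (T : Matrix (Fin 2) (Fin 2) (PowerSeries ℂ)) (i j : Fin 2) : PowerSeries ℂ :=
  X ^ 2 * derivative ℂ (T i j)
    + ((C (N.B0 i 0) + X * C (N.Binf i 0)) * T 0 j + (C (N.B0 i 1) + X * C (N.Binf i 1)) * T 1 j)
    - (T i 0 * (C (N'.B0 0 j) + X * C (N'.Binf 0 j))
      + T i 1 * (C (N'.B0 1 j) + X * C (N'.Binf 1 j)))

theorem isFormalIso_iff {N N' : BirkhoffConnection}
    {T : Matrix (Fin 2) (Fin 2) (PowerSeries ℂ)} :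
    IsFormalIso N N' T ↔
      IsUnit (T.map (PowerSeries.constantCoeff (R := ℂ))) ∧
        ∀ i j, formalEntry N N' T i j = 0 := by
  rw [IsFormalIso, ← Matrix.ext_iff]
  simp [formalEntry, formalMatrix, Matrix.mul_apply, Fin.sum_univ_two]

theorem IsHolIso.isFormalIso_taylor {N N' : BirkhoffConnection} {T : ℂ → Mat2}
    (h : IsHolIso N N' T) :
    IsFormalIso N N' (Matrix.of fun i j => taylor fun z => T z i j) := by
  obtain ⟨han, hunit, heq⟩ := h
  rw [isFormalIso_iff]
  constructor
  · convert hunit using 1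
    ext i j
    rw [Matrix.map_apply, Matrix.of_apply, ← coeff_zero_eq_constantCoeff_apply, coeff_taylor]
    simp
  · intro i j
    have hfun : (fun z => z * z * deriv (fun w => T w i j) z
        + ((N.B0 i 0 + z * N.Binf i 0) * T z 0 j + (N.B0 i 1 + z * N.Binf i 1) * T z 1 j)
        - (T z i 0 * (N'.B0 0 j + z * N'.Binf 0 j) + T z i 1 * (N'.B0 1 j + z * N'.Binf 1 j)))
        =ᶠ[𝓝 0] fun _ => 0 := by
      filter_upwards [heq] with z hz
      have := congrFun (congrFun hz i) j
      simpa [holMatrix, Matrix.mul_apply, Fin.sum_univ_two, pow_two] using this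
    have hT := fun i j => han i j
    have hd := (han i j).deriv
    have ht := taylor_congr hfun
    have hid : AnalyticAt ℂ (fun z : ℂ => z) 0 := analyticAt_id
    have hlin : ∀ a b : ℂ, AnalyticAt ℂ (fun z : ℂ => a + z * b) 0 := fun a b => by fun_prop
    have tlin : ∀ a b : ℂ, taylor (fun z => a + z * b) = C a + X * C b := fun a b => by
      rw [taylor_add analyticAt_const (by fun_prop), taylor_mul hid analyticAt_const,
        taylor_const, taylor_const, taylor_id]
    have m1 := fun a b i j => taylor_mul (hlin a b) (hT i j)
    have m2 := fun a b i j => taylor_mul (hT i j) (hlin a b)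
    have a1 := fun a b i j => (hlin a b).fun_mul (hT i j)
    have a2 := fun a b i j => (hT i j).fun_mul (hlin a b)
    rw [taylor_sub (((hid.fun_mul hid).fun_mul hd).fun_add ((a1 _ _ _ _).fun_add (a1 _ _ _ _)))
        ((a2 _ _ _ _).fun_add (a2 _ _ _ _)),
      taylor_add ((hid.fun_mul hid).fun_mul hd) ((a1 _ _ _ _).fun_add (a1 _ _ _ _)),
      taylor_add (a1 _ _ _ _) (a1 _ _ _ _), taylor_add (a2 _ _ _ _) (a2 _ _ _ _),
      m1, m1, m2, m2, taylor_mul (hid.fun_mul hid) hd, taylor_mul hid hid, taylor_id,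
      taylor_deriv, taylor_const, map_zero] at ht
    simp only [tlin] at ht
    rw [formalEntry, pow_two]
    exact ht

/-- Polynomials embed in power series, so the formal equation is an identity of polynomials and can
be evaluated at every `z`. -/
theorem IsFormalIso.holomorphicallyIsomorphic_of_polynomial {N N' : BirkhoffConnection}
    {P : Matrix (Fin 2) (Fin 2) (Polynomial ℂ)}
    (h : IsFormalIso N N' (P.map fun p => (p : PowerSeries ℂ))) :
    HolomorphicallyIsomorphic N N' := by
  rw [isFormalIso_iff] at h
  obtain ⟨hunit, heq⟩ := h
  refine ⟨fun z => P.map fun p => p.eval z, ?_, ?_, Eventually.of_forall fun z => ?_⟩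
  · intro i j
    simpa using (AnalyticAt.aeval_polynomial (analyticAt_id (𝕜 := ℂ) (z := (0 : ℂ))) (P i j))
  · convert hunit using 1
    ext i j
    simp [Polynomial.coeff_zero_eq_eval_zero]
  · ext i j
    have hp : Polynomial.X ^ 2 * Polynomial.derivative (P i j)
        + ((Polynomial.C (N.B0 i 0) + Polynomial.X * Polynomial.C (N.Binf i 0)) * P 0 j
          + (Polynomial.C (N.B0 i 1) + Polynomial.X * Polynomial.C (N.Binf i 1)) * P 1 j)
        - (P i 0 * (Polynomial.C (N'.B0 0 j) + Polynomial.X * Polynomial.C (N'.Binf 0 j))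
          + P i 1 * (Polynomial.C (N'.B0 1 j) + Polynomial.X * Polynomial.C (N'.Binf 1 j))) = 0 := by
      apply Polynomial.coe_injective ℂ
      have := heq i j
      rw [formalEntry] at this
      simp only [Matrix.map_apply, derivative_coe] at this
      push_cast
      exact this
    have := congrArg (Polynomial.eval z) hp
    simp only [Polynomial.eval_add, Polynomial.eval_sub, Polynomial.eval_mul, Polynomial.eval_pow,
      Polynomial.eval_X, Polynomial.eval_C, Polynomial.eval_zero] at this
    simpa [holMatrix, Matrix.mul_apply, Fin.sum_univ_two] using this

end BirkhoffConnection

open BirkhoffConnection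

/-! ### The equation coefficient by coefficient -/

theorem coeff_X_sq_mul_derivative (f : PowerSeries ℂ) (n : ℕ) :
    coeff (n + 1) (X ^ 2 * derivative ℂ f) = n * coeff n f := by
  rw [pow_two, mul_assoc, coeff_succ_X_mul]
  rcases n with _ | n
  · simp
  · rw [coeff_succ_X_mul, coeff_derivative]
    push_cast
    ring

/-- The coefficients of `z² ∂_z T + B T - T B'` for two normal forms, where `p k`, `q k`, `u k`,
`v k` are the entries of the coefficient of `zᵏ` in `T`, all vanish. -/
structure CoeffSystem (c α a s c' α' a' s' : ℂ) (p q u v : ℕ → ℂ) : Prop where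
  e11_zero : (c - c') * p 0 - a' * q 0 = 0
  e12_zero : (c - c') * q 0 = 0
  e21_zero : (c - c') * u 0 + a * p 0 - a' * v 0 = 0
  e22_zero : (c - c') * v 0 + a * q 0 = 0
  e11 : ∀ k : ℕ, k * p k + (c - c') * p (k + 1) + (α - α') * p k
    + a * u k - a' * q (k + 1) - s' * q k = 0
  e12 : ∀ k : ℕ, k * q k + (c - c') * q (k + 1) + (α - α') * q k
    - q k / 2 + a * v k - a' * p k = 0
  e21 : ∀ k : ℕ, k * u k + (c - c') * u (k + 1) + (α - α') * u k
    + u k / 2 + a * p (k + 1) + s * p k - a' * v (k + 1) - s' * v k = 0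
  e22 : ∀ k : ℕ, k * v k + (c - c') * v (k + 1) + (α - α') * v k
    + a * q (k + 1) + s * q k - a' * u k = 0

theorem eq_zero_iff_coeff (f : PowerSeries ℂ) :
    f = 0 ↔ coeff 0 f = 0 ∧ ∀ k, coeff (k + 1) f = 0 := by
  refine ⟨fun h => by simp [h], fun h => ?_⟩
  ext n
  rcases n with _ | n
  · simpa using h.1
  · simpa using h.2 n

theorem normalForm_isFormalIso_iff {c α a s c' α' a' s' : ℂ}
    {T : Matrix (Fin 2) (Fin 2) (PowerSeries ℂ)} :
    IsFormalIso (normalForm c α a s) (normalForm c' α' a' s') T ↔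
      coeff 0 (T 0 0) * coeff 0 (T 1 1) - coeff 0 (T 0 1) * coeff 0 (T 1 0) ≠ 0 ∧
      CoeffSystem c α a s c' α' a' s' (fun k => coeff k (T 0 0)) (fun k => coeff k (T 0 1))
        (fun k => coeff k (T 1 0)) (fun k => coeff k (T 1 1)) := by
  rw [isFormalIso_iff, Matrix.isUnit_iff_isUnit_det, isUnit_iff_ne_zero, Matrix.det_fin_two]
  refine and_congr (by simp) ?_
  have hX : ∀ (f : PowerSeries ℂ) (b d : ℂ), (C b + X * C d) * f = C b * f + X * (C d * f) :=
    fun f b d => by ring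
  have hX' : ∀ (f : PowerSeries ℂ) (b d : ℂ), f * (C b + X * C d) = C b * f + X * (C d * f) :=
    fun f b d => by ring
  have hX0 : ∀ f : PowerSeries ℂ, coeff 0 (X ^ 2 * f) = 0 := fun f => by simp
  simp only [eq_zero_iff_coeff, Fin.forall_fin_two, formalEntry, normalForm, matC1, matC2, matD, matE, hX, hX',
    hX0, map_add, map_sub, coeff_X_sq_mul_derivative, coeff_succ_X_mul, coeff_zero_X_mul, coeff_C_mul]
  simp only [Matrix.add_apply, Matrix.sub_apply, Matrix.smul_apply, Matrix.one_apply,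
    Matrix.of_apply, Matrix.cons_val', Matrix.cons_val_zero, Matrix.cons_val_one,
    Matrix.cons_val_fin_one, smul_eq_mul]
  constructor
  · rintro ⟨⟨⟨h1, h2⟩, h3, h4⟩, ⟨h5, h6⟩, h7, h8⟩
    refine ⟨?_, ?_, ?_, ?_, fun k => ?_, fun k => ?_, fun k => ?_, fun k => ?_⟩
    · linear_combination (norm := (simp; ring)) h1
    · linear_combination (norm := (simp; ring)) h3
    · linear_combination (norm := (simp; ring)) h5
    · linear_combination (norm := (simp; ring)) h7
    · linear_combination (norm := (simp; ring)) h2 k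
    · linear_combination (norm := (simp; ring)) h4 k
    · linear_combination (norm := (simp; ring)) h6 k
    · linear_combination (norm := (simp; ring)) h8 k
  · rintro ⟨h1, h3, h5, h7, h2, h4, h6, h8⟩
    refine ⟨⟨⟨?_, fun k => ?_⟩, ?_, fun k => ?_⟩, ⟨?_, fun k => ?_⟩, ?_, fun k => ?_⟩
    · linear_combination (norm := (simp; ring)) h1
    · linear_combination (norm := (simp; ring)) h2 k
    · linear_combination (norm := (simp; ring)) h3
    · linear_combination (norm := (simp; ring)) h4 k
    · linear_combination (norm := (simp; ring)) h5
    · linear_combination (norm := (simp; ring)) h6 k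
    · linear_combination (norm := (simp; ring)) h7
    · linear_combination (norm := (simp; ring)) h8 k

/-! ### Formal invariants -/

theorem invariants_eq_of_formallyIsomorphic {c α a s c' α' a' s' : ℂ} (ha : a * a' ≠ 0)
    (h : FormallyIsomorphic (normalForm c α a s) (normalForm c' α' a' s')) :
    c = c' ∧ α = α' ∧ ∃ ε : ℂ, (ε = 1 ∨ ε = -1) ∧ a = ε * a' := by
  obtain ⟨T, hT⟩ := h
  obtain ⟨hdet, hS⟩ := normalForm_isFormalIso_iff.mp hT
  have ha0 : a ≠ 0 := left_ne_zero_of_mul ha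
  have ha0' : a' ≠ 0 := right_ne_zero_of_mul ha
  have h1 := hS.e11_zero
  have h2 := hS.e12_zero
  have h3 := hS.e21_zero
  have h4 := hS.e22_zero
  have h5 := hS.e11 0
  have h6 := hS.e12 0
  have h7 := hS.e22 0
  beta_reduce at h1 h2 h3 h4 h5 h6 h7
  generalize coeff 0 (T 0 0) = p at *
  generalize coeff 0 (T 0 1) = q at *
  generalize coeff 0 (T 1 0) = u at *
  generalize coeff 0 (T 1 1) = v at *
  -- If `c ≠ c'`, the second column of `T(0)` vanishes, against invertibility.
  have hc : c = c' := by
    by_contra hne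
    have hne := sub_ne_zero.mpr hne
    have hq : q = 0 := (mul_eq_zero.mp h2).resolve_left hne
    subst hq
    have hv : v = 0 := (mul_eq_zero.mp (by simpa using h4)).resolve_left hne
    simp [hv] at hdet
  subst hc
  have hq : q = 0 := by simpa [ha0] using h4
  subst hq
  have hp : p ≠ 0 := by
    rintro rfl
    simp at hdet
  have hsq : a ^ 2 = a' ^ 2 := by
    apply mul_right_cancel₀ hp
    linear_combination a * h3 + a' * h6
  refine ⟨rfl, ?_, ?_⟩
  -- The unknowns `u 0` and `q 1` cancel in the sum (if `a = a'`) or difference (if `a = -a'`) of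
  -- the two diagonal equations.
  · have h8 : (α - α') * (2 * p * a * a') = 0 := by
      rcases sq_eq_sq_iff_eq_or_eq_neg.mp hsq with rfl | rfl
      · have : v = p := mul_left_cancel₀ ha0 (by linear_combination - h3)
        subst this
        linear_combination a ^ 2 * h5 + a ^ 2 * h7
      · have : v = - p := mul_left_cancel₀ ha0' (by linear_combination - h3)
        subst this
        linear_combination a' ^ 2 * h7 - a' ^ 2 * h5
    have h9 : 2 * p * a * a' ≠ 0 := by
      rw [mul_assoc]
      exact mul_ne_zero (mul_ne_zero two_ne_zero hp) ha
    exact sub_eq_zero.mp ((mul_eq_zero.mp h8).resolve_right h9)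
  · rcases sq_eq_sq_iff_eq_or_eq_neg.mp hsq with h | h
    · exact ⟨1, Or.inl rfl, by simpa using h⟩
    · exact ⟨-1, Or.inr rfl, by simpa using h⟩

/-! ### The recurrence and divergence of non-terminating solutions -/

/-- The polynomial in `k` governing the recurrence of the entry `T₁₂` of an isomorphism. -/
def recNum (a s t k : ℂ) : ℂ :=
  4 * a ^ 2 * (s - t) ^ 2 - 8 * k ^ 2 * a * (s + t) + (2 * k + 1) * (2 * k - 1) * k ^ 2

/-- For `ε = 1`: `e12` gives `v - p`, `e11 + e22` gives `k (p + v)`, `e22 - e11` gives `u`, all in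
terms of `q`; substitution in `e21` leaves `q` alone. Conjugation by `matD` reduces `ε = -1` to this
case, changing the signs of `q` and `v`. -/
theorem CoeffSystem.rec_q {c α a s t ε : ℂ} {p q u v : ℕ → ℂ} (hε : ε = 1 ∨ ε = -1)
    (h : CoeffSystem c α a s c α (ε * a) (ε * t) p q u v) (k : ℕ) :
    8 * a ^ 2 * k * (2 * k + 1) * q (k + 1) = recNum a s t k * q k := by
  have h1 := h.e11 k
  have h2 := h.e12 k
  have h2' := h.e12 (k + 1)
  have h3 := h.e21 k
  have h4 := h.e22 k
  push_cast at h2'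
  rw [recNum]
  rcases hε with rfl | rfl
  · linear_combination 8 * k * a ^ 2 * (h3 + h2') + 8 * k * a * (k + 1 / 2) / 2 * (h4 - h1)
      - 4 * a ^ 2 * (s - t) * (h1 + h4)
      - 8 * ((k + 1 / 2) * k ^ 2 / 2 - a * k * (s + t) / 2) * h2
  · linear_combination (-1 : ℂ) * (8 * k * a ^ 2 * (h3 - h2')
      + 8 * k * a * (k + 1 / 2) / 2 * (-h4 - h1)
      - 4 * a ^ 2 * (s - t) * (h1 - h4)
      - 8 * ((k + 1 / 2) * k ^ 2 / 2 - a * k * (s + t) / 2) * (-h2))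

/-- The recurrence is void at `k = 0`, so `q 1` has to be read off from `e21` at order 0, using `v 0
= ε * p 0`. -/
theorem CoeffSystem.q_one {c α a s t ε : ℂ} {p q u v : ℕ → ℂ} (ha : a ≠ 0)
    (hε : ε = 1 ∨ ε = -1) (h : CoeffSystem c α a s c α (ε * a) (ε * t) p q u v) :
    ε * q 1 = (t - s) * p 0 := by
  have h1 := h.e11 0
  have h2 := h.e12 1
  have h3 := h.e21 0
  have h5 := h.e21_zero
  have hq := h.e22_zero
  push_cast at h1 h2 h3
  have hq : q 0 = 0 := by simpa [ha] using hq
  rw [hq] at h1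
  rcases hε with rfl | rfl
  · have h5 : v 0 = p 0 := mul_left_cancel₀ ha (by linear_combination - h5)
    have h1 : u 0 = q 1 := mul_left_cancel₀ ha (by linear_combination h1)
    rw [h5, h1] at h3
    linear_combination h3 + h2
  · have h5 : v 0 = - p 0 := mul_left_cancel₀ ha (by linear_combination h5)
    have h1 : u 0 = - q 1 := mul_left_cancel₀ ha (by linear_combination h1)
    rw [h5, h1] at h3
    linear_combination h3 - h2

theorem not_summable_of_rec {a s t z : ℂ} {q : ℕ → ℂ} (ha : a ≠ 0) (hz : z ≠ 0)
    (hq : ∀ k, 1 ≤ k → q k ≠ 0)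
    (hrec : ∀ k : ℕ, 8 * a ^ 2 * k * (2 * k + 1) * q (k + 1) = recNum a s t k * q k) :
    ¬ Summable fun k => q k * z ^ k := by
  have hzn : 0 < ‖z‖ := norm_pos_iff.mpr hz
  refine not_summable_of_ratio_norm_eventually_ge (r := 2) one_lt_two ?_ ?_
  · refine Eventually.frequently ?_
    filter_upwards [eventually_ge_atTop 1] with k hk
    exact norm_ne_zero_iff.mpr (mul_ne_zero (hq k hk) (pow_ne_zero _ hz))
  set A : ℝ := ‖4 * a ^ 2 * (s - t) ^ 2‖ with hA
  set B : ℝ := ‖8 * a * (s + t)‖ with hB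
  -- Ratio test with ratio 2: 48 comes from `2 * 8 * k * (2k + 1) ≤ 48 * k ^ 2`, and `A + B + 1`
  -- bounds the lower-order terms of `recNum` divided by `k ^ 2`.
  obtain ⟨K, hK⟩ := exists_nat_ge (A + B + 1 + 48 * ‖a‖ ^ 2 / ‖z‖)
  filter_upwards [eventually_ge_atTop (max 1 K)] with k hk
  have hk1 : (1 : ℝ) ≤ k := by exact_mod_cast le_trans (le_max_left _ _) hk
  have hkK : (K : ℝ) ≤ k := by exact_mod_cast le_trans (le_max_right _ _) hk
  have hA0 : 0 ≤ A := norm_nonneg _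
  have hlow : (k : ℝ) ^ 2 * (4 * k ^ 2 - (A + B + 1)) ≤ ‖recNum a s t k‖ := by
    have h1 : (4 : ℂ) * k ^ 4 = recNum a s t k - 4 * a ^ 2 * (s - t) ^ 2
        + (8 * a * (s + t)) * k ^ 2 + k ^ 2 := by
      rw [recNum]
      ring
    have h2 : ‖(4 : ℂ) * k ^ 4‖ ≤ ‖recNum a s t k‖ + A + B * k ^ 2 + k ^ 2 := by
      rw [h1]
      refine (norm_add_le _ _).trans (add_le_add ((norm_add_le _ _).trans
        (add_le_add (norm_sub_le _ _) ?_)) ?_) <;> simp [hB]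
    have h3 : ‖(4 : ℂ) * k ^ 4‖ = 4 * (k : ℝ) ^ 4 := by simp
    have h4 : A ≤ A * (k : ℝ) ^ 2 := le_mul_of_one_le_right hA0 (one_le_pow₀ hk1)
    rw [h3] at h2
    nlinarith
  have hbig : 48 * ‖a‖ ^ 2 ≤ ‖z‖ * (4 * (k : ℝ) ^ 2 - (A + B + 1)) := by
    have h1 : 48 * ‖a‖ ^ 2 / ‖z‖ ≤ 4 * (k : ℝ) ^ 2 - (A + B + 1) := by nlinarith
    rw [div_le_iff₀ hzn] at h1
    linarith
  have hn := congrArg norm (hrec k)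
  have hD : ‖8 * a ^ 2 * (k : ℂ) * (2 * k + 1)‖ = 8 * ‖a‖ ^ 2 * k * (2 * k + 1) := by
    have : ‖(2 * (k : ℂ) + 1)‖ = 2 * k + 1 := by
      rw [show (2 * (k : ℂ) + 1) = ((2 * k + 1 : ℕ) : ℂ) by push_cast; rfl, Complex.norm_natCast]
      push_cast
      rfl
    rw [norm_mul, this]
    simp
  rw [norm_mul, norm_mul _ (q k), hD] at hn
  have hpos : 0 < 8 * ‖a‖ ^ 2 * k * (2 * k + 1) := by
    have := norm_pos_iff.mpr ha
    positivity
  have hmain : 2 * (8 * ‖a‖ ^ 2 * k * (2 * k + 1)) ≤ ‖recNum a s t k‖ * ‖z‖ := by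
    calc 2 * (8 * ‖a‖ ^ 2 * k * (2 * k + 1)) ≤ (k : ℝ) ^ 2 * (48 * ‖a‖ ^ 2) := by
          have : 0 ≤ ‖a‖ ^ 2 * (k * (k - 1)) :=
            mul_nonneg (sq_nonneg _) (mul_nonneg (by linarith) (by linarith))
          nlinarith
      _ ≤ (k : ℝ) ^ 2 * (‖z‖ * (4 * (k : ℝ) ^ 2 - (A + B + 1))) :=
          mul_le_mul_of_nonneg_left hbig (sq_nonneg _)
      _ = (k : ℝ) ^ 2 * (4 * k ^ 2 - (A + B + 1)) * ‖z‖ := by ring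
      _ ≤ _ := mul_le_mul_of_nonneg_right hlow hzn.le
  refine le_of_mul_le_mul_left ?_ hpos
  rw [norm_mul, norm_mul, pow_succ z, norm_mul _ z]
  calc 8 * ‖a‖ ^ 2 * k * (2 * k + 1) * (2 * (‖q k‖ * ‖z ^ k‖))
      = 2 * (8 * ‖a‖ ^ 2 * k * (2 * k + 1)) * (‖q k‖ * ‖z ^ k‖) := by ring
    _ ≤ ‖recNum a s t k‖ * ‖z‖ * (‖q k‖ * ‖z ^ k‖) :=
        mul_le_mul_of_nonneg_right hmain (by positivity)
    _ = (‖recNum a s t k‖ * ‖q k‖) * (‖z ^ k‖ * ‖z‖) := by ring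
    _ = _ := by rw [← hn]; ring

theorem exists_recNum_eq_zero {c α a s t ε : ℂ} (ha : a ≠ 0) (hε : ε = 1 ∨ ε = -1) (hst : s ≠ t)
    (h : HolomorphicallyIsomorphic (normalForm c α a s) (normalForm c α (ε * a) (ε * t))) :
    ∃ k : ℕ, 1 ≤ k ∧ recNum a s t k = 0 := by
  obtain ⟨T, hT⟩ := h
  obtain ⟨hdet, hS⟩ := normalForm_isFormalIso_iff.mp hT.isFormalIso_taylor
  obtain ⟨z, hz, hsum⟩ := exists_summable_coeff_taylor (hT.1 0 1)
  by_contra! hne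
  have hrec := hS.rec_q hε
  have hone := hS.q_one ha hε
  have hq0 := hS.e22_zero
  simp only [Matrix.of_apply, sub_self, zero_mul, zero_add, mul_eq_zero, ha, false_or]
    at hrec hone hq0 hdet
  refine not_summable_of_rec ha hz (fun k hk => ?_) hrec hsum
  induction k, hk using Nat.le_induction with
  | base =>
    intro h1
    rw [h1, mul_zero] at hone
    rcases mul_eq_zero.mp hone.symm with h2 | h2
    · exact hst (sub_eq_zero.mp h2).symm
    · rw [h2, hq0] at hdet
      simp at hdet
  | succ k hk ih =>
    intro h1
    have := hrec k
    rw [h1, mul_zero] at this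
    exact (mul_ne_zero (hne k hk) ih) this.symm

/-! ### Polynomial isomorphisms from terminating solutions -/

theorem exists_seq_of_rec {a s t : ℂ} (ha : a ≠ 0) :
    ∃ q : ℕ → ℂ, q 0 = 0 ∧ q 1 = t - s ∧
      ∀ k : ℕ, 8 * a ^ 2 * k * (2 * k + 1) * q (k + 1) = recNum a s t k * q k := by
  -- `g k` is `q (k + 1)`: the recurrence divides by `k`, so it can only start from `q 1`.
  let g : ℕ → ℂ := fun n => n.rec (t - s) fun k y =>
    recNum a s t ((k + 1 : ℕ) : ℂ) * y / (8 * a ^ 2 * ((k + 1 : ℕ) : ℂ) * (2 * ((k + 1 : ℕ) : ℂ) + 1))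
  refine ⟨fun n => n.casesOn 0 g, rfl, rfl, fun k => ?_⟩
  rcases k with _ | k
  · simp
  · have h1 : ((k + 1 : ℕ) : ℂ) ≠ 0 := by exact_mod_cast k.succ_ne_zero
    have h2 : 2 * ((k + 1 : ℕ) : ℂ) + 1 ≠ 0 := by exact_mod_cast (2 * (k + 1)).succ_ne_zero
    exact mul_div_cancel₀ _ (mul_ne_zero (mul_ne_zero (mul_ne_zero (by norm_num)
      (pow_ne_zero _ ha)) h1) h2)

theorem exists_polynomial_coeff {f : ℕ → ℂ} {m : ℕ} (hf : ∀ k, m < k → f k = 0) :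
    ∃ P : Polynomial ℂ, ∀ k, P.coeff k = f k := by
  refine ⟨∑ i ∈ Finset.range (m + 1), Polynomial.monomial i (f i), fun k => ?_⟩
  simp only [Polynomial.finsetSum_coeff, Polynomial.coeff_monomial]
  rw [Finset.sum_ite_eq' (Finset.range (m + 1)) k f]
  split_ifs with h
  · rfl
  · exact (hf k (by simpa using h)).symm

theorem exists_coeffSystem {c α a s t ε : ℂ} {m : ℕ} {q : ℕ → ℂ} (ha : a ≠ 0)
    (hε : ε = 1 ∨ ε = -1) (hq0 : q 0 = 0) (hq1 : q 1 = t - s)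
    (hrec : ∀ k : ℕ, 8 * a ^ 2 * k * (2 * k + 1) * q (k + 1) = recNum a s t k * q k)
    (hm : ∀ k, m < k → q k = 0) :
    ∃ p u v : ℕ → ℂ, CoeffSystem c α a s c α (ε * a) (ε * t) p (fun k => ε * q k) u v ∧
      p 0 * v 0 ≠ 0 ∧ ∀ k, m < k → p k = 0 ∧ u k = 0 ∧ v k = 0 := by
  -- Here `σ = p + ε v`, `δ = ε v - p` and `w = u`, as dictated by `e11`, `e12`, `e22`. The value `σ
  -- 0` is free; 2 normalises `T(0)` to have diagonal `(1, ε)`, matching `q 1 = t - s`.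
  obtain ⟨σ, hσ0, hσ⟩ : ∃ σ : ℕ → ℂ, σ 0 = 2 ∧ ∀ k, k ≠ 0 → σ k = (t - s) * q k / k :=
    ⟨fun k => if k = 0 then 2 else (t - s) * q k / k, by simp, fun k hk => by simp [hk]⟩
  obtain ⟨δ, hδ⟩ : ∃ δ : ℕ → ℂ, ∀ k, δ k = (1 / 2 - k) * q k / a := ⟨_, fun _ => rfl⟩
  obtain ⟨w, hw⟩ : ∃ w : ℕ → ℂ, ∀ k, w k = (k * δ k + 2 * a * q (k + 1) + (s + t) * q k) / (2 * a) :=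
    ⟨_, fun _ => rfl⟩
  have hσ' : ∀ k : ℕ, k * σ k = (t - s) * q k := fun k => by
    rcases eq_or_ne k 0 with rfl | hk
    · simp [hq0]
    · rw [hσ k hk]
      exact mul_div_cancel₀ _ (by exact_mod_cast hk)
  have hδ' : ∀ k : ℕ, a * δ k = (1 / 2 - k) * q k := fun k => by
    rw [hδ]
    exact mul_div_cancel₀ _ ha
  have hw' : ∀ k : ℕ, 2 * a * w k = k * δ k + 2 * a * q (k + 1) + (s + t) * q k := fun k => by
    rw [hw]
    exact mul_div_cancel₀ _ (mul_ne_zero two_ne_zero ha)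
  have hδ0 : δ 0 = 0 := by simp [hδ, hq0]
  -- The remaining equation `e21`: for `k ≠ 0` it is the recurrence up to the factor `a² k`; at `k =
  -- 0` it is the choice of `q 1`.
  have h21 : ∀ k : ℕ, (k + 1 / 2) * w k - a * δ (k + 1) + (s - t) * σ k / 2
      - (s + t) * δ k / 2 = 0 := fun k => by
    rcases eq_or_ne k 0 with rfl | hk
    · have h1 := hδ' 1
      have h2 : w 0 = q 1 := mul_left_cancel₀ (mul_ne_zero two_ne_zero ha) (by
        rw [hw' 0, hq0, hδ0]
        simp)
      rw [zero_add, h1, h2, hσ0, hδ0, hq1]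
      push_cast
      ring
    · have hk : (k : ℂ) ≠ 0 := by exact_mod_cast hk
      have h1 := hδ' (k + 1)
      have h2 := hδ' k
      have h3 := hσ' k
      have h4 := hw' k
      have h5 := hrec k
      rw [recNum] at h5
      push_cast at h1
      apply mul_left_cancel₀ (mul_ne_zero (pow_ne_zero 2 ha) hk)
      linear_combination a * k * (k + 1 / 2) / 2 * h4 - a ^ 2 * k * h1 + a ^ 2 * (s - t) / 2 * h3
        + (k ^ 2 * (k + 1 / 2) / 2 - a * k * (s + t) / 2) * h2 + h5 / 8
  refine ⟨fun k => (σ k - δ k) / 2, w, fun k => ε * ((σ k + δ k) / 2), ?_, ?_, ?_⟩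
  · have hεε : ε * ε = 1 := by rcases hε with rfl | rfl <;> norm_num
    refine ⟨?_, ?_, ?_, ?_, fun k => ?_, fun k => ?_, fun k => ?_, fun k => ?_⟩
    · simp [hq0]
    · simp
    · simp only [hδ0]
      linear_combination -(a * σ 0 / 2) * hεε
    · simp [hq0]
    · linear_combination hw' k / 2 + hσ' k / 2 - (a * q (k + 1) + t * q k) * hεε
    · linear_combination ε * hδ' k
    · linear_combination h21 k - (a * (σ (k + 1) + δ (k + 1)) / 2 + t * (σ k + δ k) / 2) * hεε
    · linear_combination ε * (hσ' k - hw' k) / 2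
  · simp only [hσ0, hδ0]
    rcases hε with rfl | rfl <;> norm_num
  · intro k hk
    have hk0 : k ≠ 0 := by omega
    have h1 := hm k hk
    have h2 := hm (k + 1) (by omega)
    simp [hσ k hk0, hw, hδ, h1, h2]

theorem holomorphicallyIsomorphic_of_seq {c α a s t ε : ℂ} {m : ℕ} {q : ℕ → ℂ} (ha : a ≠ 0)
    (hε : ε = 1 ∨ ε = -1) (hq0 : q 0 = 0) (hq1 : q 1 = t - s)
    (hrec : ∀ k : ℕ, 8 * a ^ 2 * k * (2 * k + 1) * q (k + 1) = recNum a s t k * q k)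
    (hm : q (m + 1) = 0) :
    HolomorphicallyIsomorphic (normalForm c α a s) (normalForm c α (ε * a) (ε * t)) := by
  have hm' : ∀ k, m < k → q k = 0 := fun k hk => by
    induction k, hk using Nat.le_induction with
    | base => exact hm
    | succ k hk ih =>
      have h0 : (k : ℂ) ≠ 0 := by
        have : k ≠ 0 := by omega
        exact_mod_cast this
      have h1 : 2 * (k : ℂ) + 1 ≠ 0 := by exact_mod_cast (2 * k).succ_ne_zero
      have h2 := hrec k
      rw [ih, mul_zero] at h2
      exact (mul_eq_zero.mp h2).resolve_left
        (mul_ne_zero (mul_ne_zero (mul_ne_zero (by norm_num) (pow_ne_zero _ ha)) h0) h1)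
  obtain ⟨p, u, v, hS, hdet, hv⟩ := exists_coeffSystem (c := c) (α := α) ha hε hq0 hq1 hrec hm'
  obtain ⟨P, hP⟩ := exists_polynomial_coeff fun k hk => (hv k hk).1
  obtain ⟨U, hU⟩ := exists_polynomial_coeff fun k hk => (hv k hk).2.1
  obtain ⟨V, hV⟩ := exists_polynomial_coeff fun k hk => (hv k hk).2.2
  obtain ⟨R, hR⟩ := exists_polynomial_coeff (f := fun k => ε * q k) (m := m)
    fun k hk => by simp [hm' k hk]
  refine IsFormalIso.holomorphicallyIsomorphic_of_polynomial (P := !![P, R; U, V])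
    (normalForm_isFormalIso_iff.mpr ⟨?_, ?_⟩)
  · simp only [Matrix.map_apply, Polynomial.coeff_coe, Matrix.of_apply, Matrix.cons_val',
      Matrix.cons_val_zero, Matrix.cons_val_one, Matrix.cons_val_fin_one, hP, hU, hV, hR, hq0,
      mul_zero, zero_mul, sub_zero]
    exact hdet
  · simp only [Matrix.map_apply, Polynomial.coeff_coe, Matrix.of_apply, Matrix.cons_val',
      Matrix.cons_val_zero, Matrix.cons_val_one, Matrix.cons_val_fin_one, hP, hU, hV, hR]
    exact hS

theorem holomorphicallyIsomorphic_of_eq {c α a s ε : ℂ} (ha : a ≠ 0) (hε : ε = 1 ∨ ε = -1) :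
    HolomorphicallyIsomorphic (normalForm c α a s) (normalForm c α (ε * a) (ε * s)) := by
  obtain ⟨q, hq0, hq1, hrec⟩ := exists_seq_of_rec (s := s) (t := s) ha
  -- With `s = t` the initial value `q 1` is zero, so `q` vanishes identically.
  exact holomorphicallyIsomorphic_of_seq (m := 0) ha hε hq0 hq1 hrec (by simpa using hq1)

theorem holomorphicallyIsomorphic_of_recNum_eq_zero {c α a s t ε : ℂ} {k : ℕ} (ha : a ≠ 0)
    (hε : ε = 1 ∨ ε = -1) (hk : 1 ≤ k) (h : recNum a s t k = 0) :
    HolomorphicallyIsomorphic (normalForm c α a s) (normalForm c α (ε * a) (ε * t)) := by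
  obtain ⟨q, hq0, hq1, hrec⟩ := exists_seq_of_rec (s := s) (t := t) ha
  refine holomorphicallyIsomorphic_of_seq (m := k) ha hε hq0 hq1 hrec ?_
  have h0 : (k : ℂ) ≠ 0 := by
    have : k ≠ 0 := by omega
    exact_mod_cast this
  have h1 : 2 * (k : ℂ) + 1 ≠ 0 := by exact_mod_cast (2 * k).succ_ne_zero
  have h2 := hrec k
  rw [h, zero_mul] at h2
  exact (mul_eq_zero.mp h2).resolve_left
    (mul_ne_zero (mul_ne_zero (mul_ne_zero (by norm_num) (pow_ne_zero _ ha)) h0) h1)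

/-! ### Smallest positive integral root -/

/-- A positive integral root of `recNum` exists if and only if a smallest one does; for
`2 ≤ r < n` with `n - 1` a root, `r - 1` is a root exactly when the displayed equality holds. -/
theorem exists_recNum_eq_zero_iff (a s t : ℂ) :
    (∃ k : ℕ, 1 ≤ k ∧ recNum a s t k = 0) ↔
      ∃ n : ℕ, 2 ≤ n ∧
        4 * a ^ 2 * (s - t) ^ 2 - 8 * ((n : ℂ) - 1) ^ 2 * a * (s + t)
          + (2 * (n : ℂ) - 1) * (2 * (n : ℂ) - 3) * ((n : ℂ) - 1) ^ 2 = 0 ∧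
        ∀ r : ℕ, 2 ≤ r → r ≤ n - 1 →
          a * (s + t) ≠
            ((2 * (n : ℂ) - 1) * (2 * (n : ℂ) - 3) * ((n : ℂ) - 1) ^ 2
                - (2 * (r : ℂ) - 1) * (2 * (r : ℂ) - 3) * ((r : ℂ) - 1) ^ 2)
              / (8 * ((n : ℂ) - (r : ℂ)) * ((n : ℂ) - 2 + (r : ℂ))) := by
  classical
  constructor
  · intro h
    obtain ⟨hk, hroot⟩ := Nat.find_spec h
    refine ⟨Nat.find h + 1, by omega, ?_, fun r hr hrn heq => ?_⟩
    · rw [recNum] at hroot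
      push_cast
      linear_combination hroot
    · have hlt : r - 1 < Nat.find h := by omega
      refine Nat.find_min h hlt ⟨by omega, ?_⟩
      have h1 : ((Nat.find h + 1 : ℕ) : ℂ) - r ≠ 0 := by
        rw [sub_ne_zero]
        have : Nat.find h + 1 ≠ r := by omega
        exact_mod_cast this
      have h2 : ((Nat.find h + 1 : ℕ) : ℂ) - 2 + r ≠ 0 := by
        have : ((Nat.find h + 1 : ℕ) : ℂ) - 2 + r = ((Nat.find h + (r - 1) : ℕ) : ℂ) := by
          push_cast [Nat.cast_sub (by omega : 1 ≤ r)]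
          ring
        rw [this]
        have : Nat.find h + (r - 1) ≠ 0 := by omega
        exact_mod_cast this
      -- Subtracting `recNum` at `r - 1` from `recNum` at `n - 1` eliminates `(s - t)²`; the
      -- coefficient of `a (s + t)` becomes `-8((n-1)² - (r-1)²) = -8(n - r)(n - 2 + r)`, whence the
      -- denominator.
      rw [eq_div_iff (mul_ne_zero (mul_ne_zero (by norm_num) h1) h2)] at heq
      rw [recNum] at hroot ⊢
      push_cast [Nat.cast_sub (by omega : 1 ≤ r)] at heq ⊢
      linear_combination hroot + heq
  · rintro ⟨n, hn, h, -⟩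
    refine ⟨n - 1, by omega, ?_⟩
    rw [recNum]
    push_cast [Nat.cast_sub (by omega : 1 ≤ n)]
    linear_combination h

end BirkhoffRankTwo

theorem mainTheorem6 (c α c₀ c₁ c' α' c₀' c₁' : ℂ) (hc₀ : c₀ * c₀' ≠ 0) :
    (BirkhoffRankTwo.BirkhoffConnection.FormallyIsomorphic
        (BirkhoffRankTwo.normalForm c α c₀ c₁) (BirkhoffRankTwo.normalForm c' α' c₀' c₁') →
      c = c' ∧ α = α' ∧ ∃ ε : ℂ, (ε = 1 ∨ ε = -1) ∧ c₀ = ε * c₀') ∧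
    (∀ ε : ℂ, (ε = 1 ∨ ε = -1) → c = c' → α = α' → c₀ = ε * c₀' →
      (c₁ ≠ ε * c₁' →
        (BirkhoffRankTwo.BirkhoffConnection.HolomorphicallyIsomorphic
            (BirkhoffRankTwo.normalForm c α c₀ c₁) (BirkhoffRankTwo.normalForm c' α' c₀' c₁') ↔
          ∃ n : ℕ, 2 ≤ n ∧
            4 * c₀ ^ 2 * (c₁ - ε * c₁') ^ 2 - 8 * ((n : ℂ) - 1) ^ 2 * c₀ * (c₁ + ε * c₁')
              + (2 * (n : ℂ) - 1) * (2 * (n : ℂ) - 3) * ((n : ℂ) - 1) ^ 2 = 0 ∧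
            ∀ r : ℕ, 2 ≤ r → r ≤ n - 1 →
              c₀ * (c₁ + ε * c₁') ≠
                ((2 * (n : ℂ) - 1) * (2 * (n : ℂ) - 3) * ((n : ℂ) - 1) ^ 2
                    - (2 * (r : ℂ) - 1) * (2 * (r : ℂ) - 3) * ((r : ℂ) - 1) ^ 2)
                  / (8 * ((n : ℂ) - (r : ℂ)) * ((n : ℂ) - 2 + (r : ℂ))))) ∧
      (c₁ = ε * c₁' →
        BirkhoffRankTwo.BirkhoffConnection.HolomorphicallyIsomorphic
          (BirkhoffRankTwo.normalForm c α c₀ c₁) (BirkhoffRankTwo.normalForm c' α' c₀' c₁'))) := by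
  have hc : c₀ ≠ 0 := left_ne_zero_of_mul hc₀
  refine ⟨BirkhoffRankTwo.invariants_eq_of_formallyIsomorphic hc₀, ?_⟩
  rintro ε hε rfl rfl h
  have hεε : ε * ε = 1 := by rcases hε with rfl | rfl <;> norm_num
  -- Since `ε² = 1`, the second connection has constants `ε c₀` and `ε t` with `t = ε c₁'`.
  have h0 : c₀' = ε * c₀ := by rw [h, ← mul_assoc, hεε, one_mul]
  have h1 : c₁' = ε * (ε * c₁') := by rw [← mul_assoc, hεε, one_mul]
  generalize ε * c₁' = t at h1
  subst h0 h1
  refine ⟨fun hne => ?_, ?_⟩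
  · rw [← BirkhoffRankTwo.exists_recNum_eq_zero_iff]
    exact ⟨BirkhoffRankTwo.exists_recNum_eq_zero hc hε hne, fun ⟨_, hk, hroot⟩ =>
      BirkhoffRankTwo.holomorphicallyIsomorphic_of_recNum_eq_zero hc hε hk hroot⟩
  · rintro rfl
    exact BirkhoffRankTwo.holomorphicallyIsomorphic_of_eq hc hε
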